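/- Let $(X,\mathcal B)$ be a standard Borel space and let $\mathcal F(X)$ be the real vector space of all real-valued Borel functions on $X$. Let $\sigma:X\to X$ be a surjective Borel map and let $R:\mathcal F(X)\to\mathcal F(X)$ be a normalized transfer operator over $\sigma$: $R$ is linear, $f\ge 0$ implies $R(f)\ge 0$, $R((f\circ\sigma)g)=f\,R(g)$ for all $f,g\in\mathcal F(X)$, and $R(\mathbf 1)=\mathbf 1$. For a Borel measure $\mu$ let $\mu R$ be the measure $(\mu R)(A)=\int_X R(\chi_A)\,d\mu$, and let $K_1=\{\nu R:\nu \text{ a Borel probability measure on } X\}$. Let $\mathcal H(X)$ be the universal Hilbert space, that is, the set of classes $f\sqrt{d\mu}$ of pairs $(f,\mu)$, where $\mu$ is a $\sigma$-finite Borel measure and $f\in L^2(\mu)$ is real-valued, and where $(f,\mu)\sim(g,\nu)$ if $f\sqrt{d\mu/d\lambda}=g\sqrt{d\nu/d\lambda}$ holds $\lambda$-a.e. for some $\sigma$-finite $\lambda$ with $\mu,\nu\ll\lambda$; its operations and inner product are (for any such $\lambda$) $$f\sqrt{d\mu}+g\sqrt{d\nu}=\Big(f\sqrt{\tfrac{d\mu}{d\lambda}}+g\sqrt{\tfrac{d\nu}{d\lambda}}\Big)\sqrt{d\lambda},\qquad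 c\,(f\sqrt{d\mu})=(cf)\sqrt{d\mu},\qquad \langle f\sqrt{d\mu},g\sqrt{d\nu}\rangle=\int_X fg\sqrt{\tfrac{d\mu}{d\lambda}}\sqrt{\tfrac{d\nu}{d\lambda}}\,d\lambda .$$ Let $\mathcal H_{K_1}$ be the closed linear span of all $f\sqrt{d\lambda}$ with $\lambda\in K_1$, $f\in L^2(\lambda)$. Then: 1. there is exactly one map $\widehat S:\mathcal H(X)\to\mathcal H(X)$ with $\widehat S(f\sqrt{d\lambda})=(f\circ\sigma)\sqrt{d(\lambda R)}$ for all Borel probability measures $\lambda$ and all Borel $f\in L^2(\lambda)$, and it is linear and bounded; 2. there is exactly one linear map $\widehat R:\mathcal H(X)\to\mathcal H(X)$ with $\widehat R(f\sqrt{d\lambda})=R(f)\sqrt{d(\lambda\circ\sigma^{-1})}$ for all $\lambda\in K_1$ and all Borel $f\in L^2(\lambda)$, and with $\widehat R=0$ on $\mathcal H_{K_1}^{\perp}$, and it is bounded; 3. $\widehat R=\widehat S^{*}$, so $(\widehat S,\widehat R)$ is a symmetric pair: $\langle\widehat S u,v\rangle=\langle u,\widehat R v\rangle$ for all $u,v\in\mathcal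 H(X)$. -/

import Mathlib

open MeasureTheory Filter
open scoped ENNReal

namespace UHS

noncomputable section

/-! ### Borel functions and transfer operators -/

/-- The real vector space `F(X)` of all real-valued Borel functions on `X`. -/
def BorelFun (X : Type*) [MeasurableSpace X] : Submodule ℝ (X → ℝ) where
  carrier := {f | Measurable f}
  add_mem' hf hg := hf.add hg
  zero_mem' := measurable_const
  smul_mem' c _ hf := hf.const_smul c

/-- The indicator function of a Borel set. -/
def indic {X : Type*} [MeasurableSpace X] (A : Set X) (hA : MeasurableSet A) : BorelFun X :=
  ⟨A.indicator fun _ => 1, measurable_const.indicator hA⟩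

/-- The constant function `1`. -/
def oneFun (X : Type*) [MeasurableSpace X] : BorelFun X := ⟨fun _ => 1, measurable_const⟩

/-- A transfer operator `(R, σ)`: a surjective Borel endomorphism `σ` of `X` and a positive linear
operator `R` on the space of Borel functions with the pull-out property
`R ((f ∘ σ) g) = f R(g)`. -/
structure TransferOperator (X : Type*) [MeasurableSpace X] where
  σ : X → X
  measurable_σ : Measurable σ
  surjective_σ : Function.Surjective σ
  R : BorelFun X →ₗ[ℝ] BorelFun X
  nonneg : ∀ f : BorelFun X, (∀ x, 0 ≤ f.1 x) → ∀ x, 0 ≤ (R f).1 x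
  pull_out : ∀ f g : BorelFun X,
    R ⟨fun x => f.1 (σ x) * g.1 x, (f.2.comp measurable_σ).mul g.2⟩ =
      ⟨fun x => f.1 x * (R g).1 x, f.2.mul (R g).2⟩

namespace TransferOperator

variable {X : Type*} [MeasurableSpace X]

/-- `R` is normalized: `R(1) = 1`. -/
def Normalized (T : TransferOperator X) : Prop := T.R (oneFun X) = oneFun X

theorem mono (T : TransferOperator X) {f g : BorelFun X} (h : ∀ x, f.1 x ≤ g.1 x) (x : X) :
    (T.R f).1 x ≤ (T.R g).1 x := by
  have := T.nonneg (g - f) (fun y => by simpa using h y) x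
  rw [map_sub] at this
  simpa using this

theorem R_empty (T : TransferOperator X) : T.R (indic ∅ MeasurableSet.empty) = 0 := by
  have : (indic ∅ MeasurableSet.empty : BorelFun X) = 0 := by
    ext x; simp [indic]
  rw [this, map_zero]

/-- A positive operator on the space of all Borel functions is countably additive on
indicators. -/
theorem hasSum_indic (T : TransferOperator X) (A : ℕ → Set X) (hA : ∀ i, MeasurableSet (A i))
    (hd : Pairwise (Function.onFun Disjoint A)) (x : X) :
    HasSum (fun i => (T.R (indic (A i) (hA i))).1 x)
      ((T.R (indic (⋃ i, A i) (MeasurableSet.iUnion hA))).1 x) := by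
  classical
  -- the tail indicators are bounded by `F / N` with `F = ∑ i • 1_{A i}`
  let F : BorelFun X := ⟨fun y => ∑' i, (A i).indicator (fun _ => (i : ℝ)) y, by
    exact Measurable.tsum (fun i => measurable_const.indicator (hA i))⟩
  have hF : ∀ i y, y ∈ A i → F.1 y = i := by
    intro i y hy
    change ∑' j, (A j).indicator (fun _ => (j : ℝ)) y = i
    rw [tsum_eq_single i]
    · simp [hy]
    · intro j hj
      have : y ∉ A j := fun h => Set.disjoint_left.1 (hd hj) h hy
      simp [this]
  have hF0 : ∀ y, 0 ≤ F.1 y := fun y =>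
    tsum_nonneg fun i => Set.indicator_nonneg (fun _ _ => by positivity) _
  let U : BorelFun X := indic (⋃ i, A i) (MeasurableSet.iUnion hA)
  have hsum_le : ∀ s : ℕ → BorelFun X, ∀ N, ∀ y,
      (∑ i ∈ Finset.range N, s i : BorelFun X).1 y = ∑ i ∈ Finset.range N, (s i).1 y := by
    intro s N y
    simp
  have hpt : ∀ N y, (∑ i ∈ Finset.range N, (indic (A i) (hA i)).1 y) =
      if ∃ i < N, y ∈ A i then 1 else 0 := by
    intro N y
    split_ifs with h
    · obtain ⟨i, hi, hy⟩ := h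
      rw [Finset.sum_eq_single i]
      · simp [indic, hy]
      · intro j _ hj
        have : y ∉ A j := fun h => Set.disjoint_left.1 (hd hj) h hy
        simp [indic, this]
      · intro h; simp at h; omega
    · apply Finset.sum_eq_zero
      intro i hi
      have : y ∉ A i := fun hy => h ⟨i, Finset.mem_range.1 hi, hy⟩
      simp [indic, this]
  have hle : ∀ N y, (∑ i ∈ Finset.range N, (indic (A i) (hA i)).1 y) ≤ U.1 y := by
    intro N y
    rw [hpt]
    split_ifs with h
    · obtain ⟨i, _, hy⟩ := h
      have : y ∈ ⋃ i, A i := Set.mem_iUnion.2 ⟨i, hy⟩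
      simp [U, indic, this]
    · exact Set.indicator_nonneg (fun _ _ => zero_le_one) _
  have htail : ∀ (N : ℕ) (y : X), (N : ℝ) * (U.1 y - ∑ i ∈ Finset.range N, (indic (A i) (hA i)).1 y)
      ≤ F.1 y := by
    intro N y
    by_cases hy : y ∈ ⋃ i, A i
    · obtain ⟨i, hi⟩ := Set.mem_iUnion.1 hy
      have hU : U.1 y = 1 := by simp [U, indic, -Set.mem_iUnion, hy]
      rw [hpt, hU]
      split_ifs with h
      · simpa using hF0 y
      · rw [hF i y hi]
        have : N ≤ i := by
          by_contra hlt
          exact h ⟨i, by omega, hi⟩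
        simpa using this
    · have hU : U.1 y = 0 := by simp [U, indic, -Set.mem_iUnion, hy]
      have : ¬ ∃ i < N, y ∈ A i := fun ⟨i, _, h⟩ => hy (Set.mem_iUnion.2 ⟨i, h⟩)
      rw [hpt, hU, if_neg this]
      simpa using hF0 y
  rw [hasSum_iff_tendsto_nat_of_nonneg
    (fun i => T.nonneg _ (fun y => Set.indicator_nonneg (fun _ _ => zero_le_one) _) x)]
  have hR : ∀ N, (∑ i ∈ Finset.range N, (T.R (indic (A i) (hA i))).1 x)
      = (T.R (∑ i ∈ Finset.range N, indic (A i) (hA i))).1 x := by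
    intro N
    rw [map_sum, hsum_le]
  have h1 : ∀ N, (∑ i ∈ Finset.range N, (T.R (indic (A i) (hA i))).1 x) ≤ (T.R U).1 x := by
    intro N
    rw [hR]
    exact T.mono (fun y => by rw [hsum_le]; exact hle N y) x
  have h2 : ∀ N : ℕ, (N : ℝ) * ((T.R U).1 x -
      ∑ i ∈ Finset.range N, (T.R (indic (A i) (hA i))).1 x) ≤ (T.R F).1 x := by
    intro N
    have := T.mono (f := (N : ℝ) • (U - ∑ i ∈ Finset.range N, indic (A i) (hA i))) (g := F)
      (fun y => by
        have := htail N y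
        rw [← hsum_le] at this
        exact this) x
    rw [map_smul, map_sub] at this
    rw [hR]
    exact this
  have h3 : Tendsto (fun N : ℕ => (T.R U).1 x - (T.R F).1 x / N) atTop
      (nhds ((T.R U).1 x)) := by
    simpa using tendsto_const_nhds.sub (tendsto_const_div_atTop_nhds_zero_nat ((T.R F).1 x))
  refine tendsto_of_tendsto_of_tendsto_of_le_of_le' h3 tendsto_const_nhds ?_
    (Eventually.of_forall h1)
  filter_upwards [eventually_gt_atTop 0] with N hN
  have hN' : (0 : ℝ) < N := by exact_mod_cast hN
  have := h2 N
  rw [sub_le_comm, le_div_iff₀ hN']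
  linarith

/-- The action `λ ↦ λR` of a transfer operator on measures: `(λR)(A) = ∫ R(1_A) dλ`. -/
def act (T : TransferOperator X) (μ : Measure X) : Measure X :=
  Measure.ofMeasurable (fun A hA => ∫⁻ x, ENNReal.ofReal ((T.R (indic A hA)).1 x) ∂μ)
    (by rw [T.R_empty]; simp)
    (by
      intro A hA hd
      rw [← lintegral_tsum fun i => (T.R (indic (A i) (hA i))).2.ennreal_ofReal.aemeasurable]
      refine lintegral_congr fun x => ?_
      have h := T.hasSum_indic A hA hd x
      rw [← h.tsum_eq, ENNReal.ofReal_tsum_of_nonneg _ h.summable]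
      exact fun i => T.nonneg _ (fun y => Set.indicator_nonneg (fun _ _ => zero_le_one) _) x)

theorem act_apply (T : TransferOperator X) (μ : Measure X) {A : Set X} (hA : MeasurableSet A) :
    T.act μ A = ∫⁻ x, ENNReal.ofReal ((T.R (indic A hA)).1 x) ∂μ :=
  Measure.ofMeasurable_apply A hA

/-- The set `K₁ = M₁(X) R` of measures `νR`, with `ν` a Borel probability measure. -/
def K₁ (T : TransferOperator X) : Set (Measure X) :=
  {μ | ∃ ν : Measure X, IsProbabilityMeasure ν ∧ T.act ν = μ}

end TransferOperator

/-! ### The universal Hilbert space -/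

/-- A pair `(f, μ)` with `μ` a σ-finite Borel measure on `X` and `f ∈ L²(μ)` real-valued. -/
structure Pair (X : Type*) [MeasurableSpace X] where
  f : X → ℝ
  μ : Measure X
  sigmaFinite : SigmaFinite μ
  measurable : Measurable f
  memLp : MemLp f 2 μ

attribute [instance] Pair.sigmaFinite

namespace Pair

variable {X : Type*} [MeasurableSpace X]

/-- The function `f √(dμ/dlam)`. -/
def dens (p : Pair X) (lam : Measure X) (x : X) : ℝ :=
  p.f x * √((p.μ.rnDeriv lam x).toReal)

/-- Equivalence of pairs: `f √(dμ/dlam) = g √(dν/dlam)` holds `lam`-a.e. for some σ-finite `lam`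
with `μ ≪ lam` and `ν ≪ lam`. -/
def Rel (p q : Pair X) : Prop :=
  ∃ lam : Measure X, SigmaFinite lam ∧ p.μ ≪ lam ∧ q.μ ≪ lam ∧ p.dens lam =ᵐ[lam] q.dens lam

theorem measurable_dens (p : Pair X) (lam : Measure X) : Measurable (p.dens lam) :=
  p.measurable.mul (Measure.measurable_rnDeriv _ _).ennreal_toReal.sqrt

theorem dens_chain (p : Pair X) {lam lam' : Measure X} [SigmaFinite lam] [SigmaFinite lam']
    (h : p.μ ≪ lam) :
    p.dens lam' =ᵐ[lam'] fun x => p.dens lam x * √((lam.rnDeriv lam' x).toReal) := by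
  filter_upwards [Measure.rnDeriv_mul_rnDeriv (κ := lam') h] with x hx
  simp only [dens]
  rw [← hx, Pi.mul_apply, ENNReal.toReal_mul, Real.sqrt_mul ENNReal.toReal_nonneg, mul_assoc]

theorem ae_eq_iff_mul_sqrt {lam lam' : Measure X} [SigmaFinite lam] [SigmaFinite lam']
    (h : lam ≪ lam') (f g : X → ℝ) :
    f =ᵐ[lam] g ↔ (fun x => f x * √((lam.rnDeriv lam' x).toReal)) =ᵐ[lam']
      fun x => g x * √((lam.rnDeriv lam' x).toReal) := by
  have h1 : f =ᵐ[lam] g ↔ ∀ᵐ x ∂lam', lam.rnDeriv lam' x ≠ 0 → f x = g x := by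
    conv_lhs => rw [← Measure.withDensity_rnDeriv_eq lam lam' h]
    exact ae_withDensity_iff (Measure.measurable_rnDeriv _ _)
  rw [h1]
  constructor
  · intro H
    filter_upwards [H] with x hx
    by_cases h0 : lam.rnDeriv lam' x = 0
    · simp [h0]
    · rw [hx h0]
  · intro H
    filter_upwards [H, Measure.rnDeriv_lt_top lam lam'] with x hx hlt h0
    refine mul_right_cancel₀ ?_ hx
    exact (Real.sqrt_pos.2 (ENNReal.toReal_pos h0 hlt.ne)).ne'

theorem dens_eq_mono (p q : Pair X) {lam lam' : Measure X} [SigmaFinite lam] [SigmaFinite lam']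
    (hp : p.μ ≪ lam) (hq : q.μ ≪ lam) (h : lam ≪ lam') :
    p.dens lam =ᵐ[lam] q.dens lam ↔ p.dens lam' =ᵐ[lam'] q.dens lam' := by
  rw [ae_eq_iff_mul_sqrt h]
  constructor
  · intro H
    exact (p.dens_chain hp).trans (H.trans (q.dens_chain hq).symm)
  · intro H
    exact (p.dens_chain hp).symm.trans (H.trans (q.dens_chain hq))

/-- The equivalence of pairs may be tested with any dominating measure. -/
theorem rel_iff (p q : Pair X) {lam : Measure X} [SigmaFinite lam]
    (hp : p.μ ≪ lam) (hq : q.μ ≪ lam) : Rel p q ↔ p.dens lam =ᵐ[lam] q.dens lam := by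
  constructor
  · rintro ⟨lam', hs, hp', hq', H⟩
    have h1 : lam ≪ lam + lam' := Measure.AbsolutelyContinuous.rfl.add_right _
    have h2 : lam' ≪ lam + lam' := by
      rw [add_comm]; exact Measure.AbsolutelyContinuous.rfl.add_right _
    rw [dens_eq_mono p q hp hq h1, ← dens_eq_mono p q hp' hq' h2]
    exact H
  · intro H
    exact ⟨lam, inferInstance, hp, hq, H⟩

instance setoid (X : Type*) [MeasurableSpace X] : Setoid (Pair X) where
  r := Rel
  iseqv :=
    { refl := fun p =>
        ⟨p.μ, inferInstance, Measure.AbsolutelyContinuous.rfl, Measure.AbsolutelyContinuous.rfl,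
          EventuallyEq.rfl⟩
      symm := fun ⟨lam, hs, hp, hq, H⟩ => ⟨lam, hs, hq, hp, H.symm⟩
      trans := by
        intro p q r hpq hqr
        have hp : p.μ ≪ p.μ + q.μ + r.μ :=
          (Measure.AbsolutelyContinuous.rfl.add_right _).add_right _
        have hq : q.μ ≪ p.μ + q.μ + r.μ := by
          rw [add_comm p.μ]; exact (Measure.AbsolutelyContinuous.rfl.add_right _).add_right _
        have hr : r.μ ≪ p.μ + q.μ + r.μ := by
          rw [add_comm]; exact Measure.AbsolutelyContinuous.rfl.add_right _
        exact (rel_iff p r hp hr).2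
          (((rel_iff p q hp hq).1 hpq).trans ((rel_iff q r hq hr).1 hqr)) }

theorem integrable_dens_mul (p q : Pair X) {lam : Measure X}
    (hp : MemLp (p.dens lam) 2 lam) (hq : MemLp (q.dens lam) 2 lam) :
    Integrable (fun x => p.dens lam x * q.dens lam x) lam := by
  exact hp.integrable_mul hq

theorem memLp_dens (p : Pair X) {lam : Measure X} [SigmaFinite lam] (hp : p.μ ≪ lam) :
    MemLp (p.dens lam) 2 lam := by
  rw [memLp_two_iff_integrable_sq (p.measurable_dens lam).aestronglyMeasurable]
  have h : Integrable (fun x => p.f x ^ 2) p.μ := p.memLp.integrable_sq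
  have := (integrable_rnDeriv_smul_iff hp (f := fun x => p.f x ^ 2)).2 h
  refine this.congr (Eventually.of_forall fun x => ?_)
  simp only [dens, smul_eq_mul, mul_pow, Real.sq_sqrt ENNReal.toReal_nonneg]
  ring

/-- `∫ f √(dμ/dlam) g √(dν/dlam) dlam`. -/
def innerAt (p q : Pair X) (lam : Measure X) : ℝ := ∫ x, p.dens lam x * q.dens lam x ∂lam

theorem innerAt_mono (p q : Pair X) {lam lam' : Measure X} [SigmaFinite lam] [SigmaFinite lam']
    (hp : p.μ ≪ lam) (hq : q.μ ≪ lam) (h : lam ≪ lam') :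
    innerAt p q lam' = innerAt p q lam := by
  unfold innerAt
  rw [← integral_rnDeriv_smul h]
  apply integral_congr_ae
  filter_upwards [p.dens_chain (lam' := lam') hp, q.dens_chain (lam' := lam') hq] with x h1 h2
  rw [h1, h2, smul_eq_mul]
  have := Real.mul_self_sqrt (ENNReal.toReal_nonneg (a := lam.rnDeriv lam' x))
  calc _ = (√((lam.rnDeriv lam' x).toReal) * √((lam.rnDeriv lam' x).toReal)) *
        (p.dens lam x * q.dens lam x) := by ring
    _ = _ := by rw [this]

/-- The inner product does not depend on the dominating measure. -/
theorem innerAt_indep (p q : Pair X) {lam lam' : Measure X} [SigmaFinite lam] [SigmaFinite lam']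
    (hp : p.μ ≪ lam) (hq : q.μ ≪ lam) (hp' : p.μ ≪ lam') (hq' : q.μ ≪ lam') :
    innerAt p q lam = innerAt p q lam' := by
  have h1 : lam ≪ lam + lam' := Measure.AbsolutelyContinuous.rfl.add_right _
  have h2 : lam' ≪ lam + lam' := by
    rw [add_comm]; exact Measure.AbsolutelyContinuous.rfl.add_right _
  rw [← innerAt_mono p q hp hq h1, ← innerAt_mono p q hp' hq' h2]

theorem ac_left (μ ν : Measure X) : μ ≪ μ + ν := Measure.AbsolutelyContinuous.rfl.add_right _

theorem ac_right (μ ν : Measure X) : ν ≪ μ + ν := by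
  rw [add_comm]; exact Measure.AbsolutelyContinuous.rfl.add_right _

/-- `(f, μ) + (g, ν) = (f √(dμ/dlam) + g √(dν/dlam), lam)` with `lam = μ + ν`. -/
def add (p q : Pair X) : Pair X where
  f x := p.dens (p.μ + q.μ) x + q.dens (p.μ + q.μ) x
  μ := p.μ + q.μ
  sigmaFinite := inferInstance
  measurable := (p.measurable_dens _).add (q.measurable_dens _)
  memLp := (p.memLp_dens (ac_left _ _)).add (q.memLp_dens (ac_right _ _))

/-- `c (f, μ) = (c f, μ)`. -/
def smul (c : ℝ) (p : Pair X) : Pair X where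
  f x := c * p.f x
  μ := p.μ
  sigmaFinite := inferInstance
  measurable := p.measurable.const_mul c
  memLp := p.memLp.const_mul c

/-- The pair `(0, 0)`. -/
def zero (X : Type*) [MeasurableSpace X] : Pair X where
  f _ := 0
  μ := 0
  sigmaFinite := inferInstance
  measurable := measurable_const
  memLp := by simp

theorem dens_add (p q : Pair X) {lam : Measure X} [SigmaFinite lam]
    (hp : p.μ ≪ lam) (hq : q.μ ≪ lam) :
    (p.add q).dens lam =ᵐ[lam] fun x => p.dens lam x + q.dens lam x := by
  filter_upwards [p.dens_chain (lam' := lam) (ac_left p.μ q.μ),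
    q.dens_chain (lam' := lam) (ac_right p.μ q.μ)] with x h1 h2
  rw [h1, h2, ← add_mul]
  rfl

theorem dens_smul (c : ℝ) (p : Pair X) (lam : Measure X) (x : X) :
    (smul c p).dens lam x = c * p.dens lam x := mul_assoc _ _ _

theorem dens_zero (lam : Measure X) (x : X) : (zero X).dens lam x = 0 := zero_mul _

theorem add_ac (p q : Pair X) {lam : Measure X} (hp : p.μ ≪ lam) (hq : q.μ ≪ lam) :
    (p.add q).μ ≪ lam := hp.add_left hq

end Pair

/-- The universal Hilbert space `H(X)`: equivalence classes `f √dμ` of pairs `(f, μ)`. -/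
def UniversalHilbert (X : Type*) [MeasurableSpace X] : Type _ := Quotient (Pair.setoid X)

namespace UniversalHilbert

variable {X : Type*} [MeasurableSpace X]

/-- The class `f √dμ` of a pair `(f, μ)`. -/
def mk (p : Pair X) : UniversalHilbert X := Quotient.mk _ p

theorem mk_surj (v : UniversalHilbert X) : ∃ p, mk p = v := Quotient.exists_rep v

theorem mk_eq_mk {p q : Pair X} {lam : Measure X} [SigmaFinite lam]
    (hp : p.μ ≪ lam) (hq : q.μ ≪ lam) : mk p = mk q ↔ p.dens lam =ᵐ[lam] q.dens lam :=
  Quotient.eq.trans (Pair.rel_iff p q hp hq)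

theorem rel_dens {p q : Pair X} (h : p ≈ q) {lam : Measure X} [SigmaFinite lam]
    (hp : p.μ ≪ lam) (hq : q.μ ≪ lam) : p.dens lam =ᵐ[lam] q.dens lam :=
  (Pair.rel_iff p q hp hq).1 h

instance : Zero (UniversalHilbert X) := ⟨mk (Pair.zero X)⟩

instance : Add (UniversalHilbert X) :=
  ⟨Quotient.map₂ Pair.add (by
    intro p p' hp q q' hq
    have a1 := Pair.ac_left p.μ (p'.μ + (q.μ + q'.μ))
    have a2 := (Pair.ac_left p'.μ (q.μ + q'.μ)).trans (Pair.ac_right p.μ _)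
    have a3 := ((Pair.ac_left q.μ q'.μ).trans (Pair.ac_right p'.μ _)).trans (Pair.ac_right p.μ _)
    have a4 := ((Pair.ac_right q.μ q'.μ).trans (Pair.ac_right p'.μ _)).trans (Pair.ac_right p.μ _)
    refine (Pair.rel_iff _ _ (Pair.add_ac p q a1 a3) (Pair.add_ac p' q' a2 a4)).2 ?_
    filter_upwards [Pair.dens_add p q a1 a3, Pair.dens_add p' q' a2 a4, rel_dens hp a1 a2,
      rel_dens hq a3 a4] with x h1 h2 h3 h4
    rw [h1, h2, h3, h4])⟩

instance : SMul ℝ (UniversalHilbert X) :=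
  ⟨fun c => Quotient.map (Pair.smul c) (by
    intro p q h
    have a1 := Pair.ac_left p.μ q.μ
    have a2 := Pair.ac_right p.μ q.μ
    refine (Pair.rel_iff (Pair.smul c p) (Pair.smul c q) a1 a2).2 ?_
    filter_upwards [rel_dens h a1 a2] with x h1
    rw [Pair.dens_smul, Pair.dens_smul, h1])⟩

instance : Neg (UniversalHilbert X) := ⟨fun v => (-1 : ℝ) • v⟩

theorem mk_add (p q : Pair X) : mk p + mk q = mk (p.add q) := rfl

theorem mk_smul (c : ℝ) (p : Pair X) : c • mk p = mk (p.smul c) := rfl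

theorem mk_zero : (0 : UniversalHilbert X) = mk (Pair.zero X) := rfl

theorem neg_def (v : UniversalHilbert X) : -v = (-1 : ℝ) • v := rfl

theorem zero_ac (lam : Measure X) : (Pair.zero X).μ ≪ lam :=
  Measure.AbsolutelyContinuous.zero lam

theorem smul_ac (c : ℝ) (p : Pair X) {lam : Measure X} (h : p.μ ≪ lam) : (p.smul c).μ ≪ lam := h

instance : AddCommGroup (UniversalHilbert X) where
  add_assoc u v w := by
    obtain ⟨p, rfl⟩ := mk_surj u
    obtain ⟨q, rfl⟩ := mk_surj v
    obtain ⟨r, rfl⟩ := mk_surj w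
    have a1 := Pair.ac_left p.μ (q.μ + r.μ)
    have a2 := (Pair.ac_left q.μ r.μ).trans (Pair.ac_right p.μ _)
    have a3 := (Pair.ac_right q.μ r.μ).trans (Pair.ac_right p.μ _)
    have b1 := Pair.add_ac p q a1 a2
    have b2 := Pair.add_ac q r a2 a3
    rw [mk_add, mk_add, mk_add, mk_add, mk_eq_mk (Pair.add_ac _ _ b1 a3) (Pair.add_ac _ _ a1 b2)]
    filter_upwards [Pair.dens_add _ _ b1 a3, Pair.dens_add _ _ a1 b2, Pair.dens_add _ _ a1 a2,
      Pair.dens_add _ _ a2 a3] with x h1 h2 h3 h4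
    rw [h1, h2, h3, h4, add_assoc]
  zero_add u := by
    obtain ⟨p, rfl⟩ := mk_surj u
    have a1 := Measure.AbsolutelyContinuous.refl p.μ
    rw [mk_zero, mk_add, mk_eq_mk (Pair.add_ac _ _ (zero_ac _) a1) a1]
    filter_upwards [Pair.dens_add _ _ (zero_ac _) a1] with x h1
    rw [h1, Pair.dens_zero, zero_add]
  add_zero u := by
    obtain ⟨p, rfl⟩ := mk_surj u
    have a1 := Measure.AbsolutelyContinuous.refl p.μ
    rw [mk_zero, mk_add, mk_eq_mk (Pair.add_ac _ _ a1 (zero_ac _)) a1]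
    filter_upwards [Pair.dens_add _ _ a1 (zero_ac _)] with x h1
    rw [h1, Pair.dens_zero, add_zero]
  nsmul := nsmulRec
  zsmul := zsmulRec
  neg_add_cancel u := by
    obtain ⟨p, rfl⟩ := mk_surj u
    have a1 := Measure.AbsolutelyContinuous.refl p.μ
    have a2 := smul_ac (-1) p a1
    rw [neg_def, mk_smul, mk_add, mk_zero, mk_eq_mk (Pair.add_ac _ _ a2 a1) (zero_ac _)]
    filter_upwards [Pair.dens_add _ _ a2 a1] with x h1
    rw [h1, Pair.dens_zero, Pair.dens_smul]
    ring
  add_comm u v := by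
    obtain ⟨p, rfl⟩ := mk_surj u
    obtain ⟨q, rfl⟩ := mk_surj v
    have a1 := Pair.ac_left p.μ q.μ
    have a2 := Pair.ac_right p.μ q.μ
    rw [mk_add, mk_add, mk_eq_mk (Pair.add_ac _ _ a1 a2) (Pair.add_ac _ _ a2 a1)]
    filter_upwards [Pair.dens_add _ _ a1 a2, Pair.dens_add _ _ a2 a1] with x h1 h2
    rw [h1, h2, add_comm]

instance : Module ℝ (UniversalHilbert X) where
  one_smul u := by
    obtain ⟨p, rfl⟩ := mk_surj u
    have a1 := Measure.AbsolutelyContinuous.refl p.μ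
    rw [mk_smul, mk_eq_mk (smul_ac _ p a1) a1]
    exact Eventually.of_forall fun x => by rw [Pair.dens_smul, one_mul]
  mul_smul c d u := by
    obtain ⟨p, rfl⟩ := mk_surj u
    have a1 := Measure.AbsolutelyContinuous.refl p.μ
    rw [mk_smul, mk_smul, mk_smul, mk_eq_mk (smul_ac _ p a1) (smul_ac _ _ (smul_ac _ p a1))]
    exact Eventually.of_forall fun x => by
      rw [Pair.dens_smul, Pair.dens_smul, Pair.dens_smul, mul_assoc]
  smul_zero c := by
    rw [mk_zero, mk_smul, mk_eq_mk (smul_ac _ _ (zero_ac 0)) (zero_ac 0)]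
    exact Eventually.of_forall fun x => by
      rw [Pair.dens_smul, Pair.dens_zero, mul_zero]
  zero_smul u := by
    obtain ⟨p, rfl⟩ := mk_surj u
    have a1 := Measure.AbsolutelyContinuous.refl p.μ
    rw [mk_zero, mk_smul, mk_eq_mk (smul_ac _ p a1) (zero_ac _)]
    exact Eventually.of_forall fun x => by rw [Pair.dens_smul, Pair.dens_zero, zero_mul]
  smul_add c u v := by
    obtain ⟨p, rfl⟩ := mk_surj u
    obtain ⟨q, rfl⟩ := mk_surj v
    have a1 := Pair.ac_left p.μ q.μ
    have a2 := Pair.ac_right p.μ q.μ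
    have b1 := smul_ac c p a1
    have b2 := smul_ac c q a2
    rw [mk_add, mk_smul, mk_smul, mk_smul, mk_add,
      mk_eq_mk (smul_ac c _ (Pair.add_ac _ _ a1 a2)) (Pair.add_ac _ _ b1 b2)]
    filter_upwards [Pair.dens_add _ _ a1 a2, Pair.dens_add _ _ b1 b2] with x h1 h2
    rw [Pair.dens_smul, h1, h2, Pair.dens_smul, Pair.dens_smul, mul_add]
  add_smul c d u := by
    obtain ⟨p, rfl⟩ := mk_surj u
    have a1 := Measure.AbsolutelyContinuous.refl p.μ
    have b1 := smul_ac c p a1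
    have b2 := smul_ac d p a1
    rw [mk_smul, mk_smul, mk_smul, mk_add, mk_eq_mk (smul_ac _ p a1) (Pair.add_ac _ _ b1 b2)]
    filter_upwards [Pair.dens_add _ _ b1 b2] with x h2
    rw [Pair.dens_smul, h2, Pair.dens_smul, Pair.dens_smul, add_mul]

theorem innerAt_congr {p p' q q' : Pair X} {lam : Measure X}
    (h : p.dens lam =ᵐ[lam] p'.dens lam) (h' : q.dens lam =ᵐ[lam] q'.dens lam) :
    p.innerAt q lam = p'.innerAt q' lam := by
  apply integral_congr_ae
  filter_upwards [h, h'] with x h1 h2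
  rw [h1, h2]

/-- `⟨f √dμ, g √dν⟩ = ∫ f g √(dμ/dlam) √(dν/dlam) dlam` with `lam = μ + ν`. -/
def innerFun (u v : UniversalHilbert X) : ℝ :=
  Quotient.liftOn₂ u v (fun p q => p.innerAt q (p.μ + q.μ)) (by
    intro p q p' q' hp hq
    have a1 := Pair.ac_left p.μ (p'.μ + (q.μ + q'.μ))
    have a2 := (Pair.ac_left p'.μ (q.μ + q'.μ)).trans (Pair.ac_right p.μ _)
    have a3 := ((Pair.ac_left q.μ q'.μ).trans (Pair.ac_right p'.μ _)).trans (Pair.ac_right p.μ _)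
    have a4 := ((Pair.ac_right q.μ q'.μ).trans (Pair.ac_right p'.μ _)).trans (Pair.ac_right p.μ _)
    change p.innerAt q (p.μ + q.μ) = p'.innerAt q' (p'.μ + q'.μ)
    rw [Pair.innerAt_indep p q (Pair.ac_left _ _) (Pair.ac_right _ _) a1 a3,
      Pair.innerAt_indep p' q' (Pair.ac_left _ _) (Pair.ac_right _ _) a2 a4]
    exact innerAt_congr (rel_dens hp a1 a2) (rel_dens hq a3 a4))

theorem innerFun_mk (p q : Pair X) {lam : Measure X} [SigmaFinite lam]
    (hp : p.μ ≪ lam) (hq : q.μ ≪ lam) :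
    innerFun (mk p) (mk q) = ∫ x, p.dens lam x * q.dens lam x ∂lam :=
  Pair.innerAt_indep p q (Pair.ac_left _ _) (Pair.ac_right _ _) hp hq

instance core : InnerProductSpace.Core ℝ (UniversalHilbert X) where
  inner := innerFun
  conj_inner_symm u v := by
    obtain ⟨p, rfl⟩ := mk_surj u
    obtain ⟨q, rfl⟩ := mk_surj v
    have a1 := Pair.ac_left p.μ q.μ
    have a2 := Pair.ac_right p.μ q.μ
    change innerFun (mk q) (mk p) = innerFun (mk p) (mk q)
    rw [innerFun_mk _ _ a1 a2, innerFun_mk _ _ a2 a1]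
    exact integral_congr_ae (Eventually.of_forall fun x => mul_comm _ _)
  re_inner_nonneg u := by
    obtain ⟨p, rfl⟩ := mk_surj u
    have a1 := Measure.AbsolutelyContinuous.refl p.μ
    change 0 ≤ innerFun (mk p) (mk p)
    rw [innerFun_mk _ _ a1 a1]
    exact integral_nonneg fun x => mul_self_nonneg _
  add_left u v w := by
    obtain ⟨p, rfl⟩ := mk_surj u
    obtain ⟨q, rfl⟩ := mk_surj v
    obtain ⟨r, rfl⟩ := mk_surj w
    have a1 := Pair.ac_left p.μ (q.μ + r.μ)
    have a2 := (Pair.ac_left q.μ r.μ).trans (Pair.ac_right p.μ _)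
    have a3 := (Pair.ac_right q.μ r.μ).trans (Pair.ac_right p.μ _)
    change innerFun (mk p + mk q) (mk r) = innerFun (mk p) (mk r) + innerFun (mk q) (mk r)
    rw [mk_add, innerFun_mk _ _ (Pair.add_ac _ _ a1 a2) a3, innerFun_mk _ _ a1 a3,
      innerFun_mk _ _ a2 a3, ← integral_add
        (Pair.integrable_dens_mul _ _ (p.memLp_dens a1) (r.memLp_dens a3))
        (Pair.integrable_dens_mul _ _ (q.memLp_dens a2) (r.memLp_dens a3))]
    apply integral_congr_ae
    filter_upwards [Pair.dens_add _ _ a1 a2] with x h1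
    rw [h1, add_mul]
  smul_left u v c := by
    obtain ⟨p, rfl⟩ := mk_surj u
    obtain ⟨q, rfl⟩ := mk_surj v
    have a1 := Pair.ac_left p.μ q.μ
    have a2 := Pair.ac_right p.μ q.μ
    change innerFun (c • mk p) (mk q) = c * innerFun (mk p) (mk q)
    rw [mk_smul, innerFun_mk _ _ (smul_ac c p a1) a2, innerFun_mk _ _ a1 a2,
      ← integral_const_mul]
    refine integral_congr_ae (Eventually.of_forall fun x => ?_)
    simp only [Pair.dens_smul, mul_assoc]
  definite u h := by
    obtain ⟨p, rfl⟩ := mk_surj u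
    have a1 := Measure.AbsolutelyContinuous.refl p.μ
    replace h : innerFun (mk p) (mk p) = 0 := h
    rw [innerFun_mk _ _ a1 a1, integral_eq_zero_iff_of_nonneg (fun x => mul_self_nonneg _)
      (Pair.integrable_dens_mul _ _ (p.memLp_dens a1) (p.memLp_dens a1))] at h
    rw [mk_zero, mk_eq_mk a1 (zero_ac _)]
    filter_upwards [h] with x hx
    rw [Pair.dens_zero]
    exact mul_self_eq_zero.1 hx

instance : NormedAddCommGroup (UniversalHilbert X) :=
  (core (X := X)).toNormedAddCommGroup

instance : InnerProductSpace ℝ (UniversalHilbert X) :=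
  InnerProductSpace.ofCore (core (X := X)).toCore

theorem inner_mk (p q : Pair X) {lam : Measure X} [SigmaFinite lam]
    (hp : p.μ ≪ lam) (hq : q.μ ≪ lam) :
    inner ℝ (mk p) (mk q) = ∫ x, p.dens lam x * q.dens lam x ∂lam :=
  innerFun_mk p q hp hq

theorem norm_mk_sub (p q : Pair X) {lam : Measure X} [SigmaFinite lam]
    (hp : p.μ ≪ lam) (hq : q.μ ≪ lam) :
    ‖mk p - mk q‖ = ‖(p.memLp_dens hp).toLp - (q.memLp_dens hq).toLp‖ := by
  have h1 : mk p - mk q = mk (p.add (q.smul (-1))) := by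
    rw [sub_eq_add_neg, neg_def, mk_smul, mk_add]
  have a := Pair.add_ac p _ hp (smul_ac (-1) q hq)
  rw [← sq_eq_sq₀ (norm_nonneg _) (norm_nonneg _), ← real_inner_self_eq_norm_sq,
    ← real_inner_self_eq_norm_sq, h1, inner_mk _ _ a a, L2.inner_def]
  apply integral_congr_ae
  filter_upwards [Pair.dens_add p _ hp (smul_ac (-1) q hq),
    Lp.coeFn_sub (p.memLp_dens hp).toLp (q.memLp_dens hq).toLp,
    (p.memLp_dens hp).coeFn_toLp, (q.memLp_dens hq).coeFn_toLp] with x h2 h3 h4 h5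
  rw [h2, h3, Pi.sub_apply, h4, h5, Pair.dens_smul]
  simp only [RCLike.inner_apply, conj_trivial]
  ring

instance : CompleteSpace (UniversalHilbert X) := by
  refine Metric.complete_of_cauchySeq_tendsto fun u hu => ?_
  choose p hp using fun n => mk_surj (u n)
  let lam : Measure X := (Measure.sum fun n => (p n).μ).toFinite
  have hac : ∀ n, (p n).μ ≪ lam := fun n =>
    (Measure.absolutelyContinuous_sum_right n Measure.AbsolutelyContinuous.rfl).trans
      (absolutelyContinuous_toFinite _)
  let g : ℕ → Lp ℝ 2 lam := fun n => ((p n).memLp_dens (hac n)).toLp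
  have hg : CauchySeq g := by
    rw [Metric.cauchySeq_iff] at hu ⊢
    intro ε hε
    obtain ⟨N, hN⟩ := hu ε hε
    refine ⟨N, fun m hm n hn => ?_⟩
    have := hN m hm n hn
    rwa [← hp m, ← hp n, dist_eq_norm, norm_mk_sub _ _ (hac m) (hac n), ← dist_eq_norm] at this
  obtain ⟨G, hG⟩ := cauchySeq_tendsto_of_complete hg
  have hGm := (Lp.aestronglyMeasurable G).aemeasurable
  let q : Pair X :=
    { f := hGm.mk G
      μ := lam
      sigmaFinite := inferInstance
      measurable := hGm.measurable_mk
      memLp := (memLp_congr_ae hGm.ae_eq_mk).1 (Lp.memLp G) }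
  have hq : q.μ ≪ lam := Measure.AbsolutelyContinuous.rfl
  have hqG : (q.memLp_dens hq).toLp = G := by
    apply Lp.ext
    filter_upwards [(q.memLp_dens hq).coeFn_toLp, hGm.ae_eq_mk, Measure.rnDeriv_self lam]
      with x h1 h2 h3
    rw [h1, h2]
    change hGm.mk G x * √((lam.rnDeriv lam x).toReal) = _
    rw [h3]
    simp
  refine ⟨mk q, ?_⟩
  rw [tendsto_iff_norm_sub_tendsto_zero] at hG ⊢
  refine hG.congr fun n => ?_
  rw [← hp n, norm_mk_sub _ _ (hac n) hq, hqG]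

/-- `v.IsClass f μ` says that `(f, μ)` is a pair (`μ` is σ-finite, `f` is Borel and `f ∈ L²(μ)`)
and that `v = f √dμ`. -/
def IsClass (v : UniversalHilbert X) (f : X → ℝ) (μ : Measure X) : Prop :=
  ∃ p : Pair X, p.f = f ∧ p.μ = μ ∧ mk p = v

/-- For a set `G` of measures, the closed span `H_G` of the subspaces
`H(μ) = {f √dμ | f ∈ L²(μ)}`, `μ ∈ G`. -/
def closedSpan (G : Set (Measure X)) : Submodule ℝ (UniversalHilbert X) :=
  (Submodule.span ℝ {v | ∃ μ ∈ G, ∃ f : X → ℝ, v.IsClass f μ}).topologicalClosure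

end UniversalHilbert

namespace TransferOperator

variable {X : Type*} [MeasurableSpace X]

/-- The defining property of `Ŝ`: `Ŝ (f √dμ) = (f ∘ σ) √d(μR)` for all Borel probability
measures `μ` and all `f ∈ L²(μ)`. -/
def IsSHat (T : TransferOperator X) (S : UniversalHilbert X → UniversalHilbert X) : Prop :=
  ∀ (v : UniversalHilbert X) (f : X → ℝ) (μ : Measure X), IsProbabilityMeasure μ →
    v.IsClass f μ → (S v).IsClass (f ∘ T.σ) (T.act μ)

/-- The defining property of `R̂`: `R̂ (f √dμ) = R(f) √d(μ ∘ σ⁻¹)` for all `μ ∈ K₁` and all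
`f ∈ L²(μ)`, and `R̂ = 0` on the orthogonal complement of `H_{K₁}`. -/
structure IsRHat (T : TransferOperator X) (R' : UniversalHilbert X → UniversalHilbert X) :
    Prop where
  of_K₁ : ∀ (v : UniversalHilbert X) (f : BorelFun X) (μ : Measure X), μ ∈ T.K₁ →
    v.IsClass f.1 μ → (R' v).IsClass (T.R f).1 (μ.map T.σ)
  of_orthogonal : ∀ v ∈ (UniversalHilbert.closedSpan T.K₁)ᗮ, R' v = 0

end TransferOperator

end

end UHS

/-! Because `R` acts on every Borel function, it is given by a kernel: with `fiber x = δ_x R`, one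
has `R f x = ∫ f d(fiber x)` for every Borel `f` (`R_eq_integral`), and `μR` is `μ` integrated
against this kernel (`act_eq_bind`). The pull-out property concentrates `fiber x` on `σ⁻¹{x}`
(`ae_fiber`), and normalization makes it a probability measure.

Hence `σ` carries `μR` to `μ` (`measurePreserving_act`), and `d(μR)/d(νR) = (dμ/dν) ∘ σ`
(`rnDeriv_act`). Densities of pairs are therefore simply composed with `σ`, so `f√dμ ↦ (f ∘
σ)√d(μR)` is well defined, linear and isometric. Take `R̂` to be its adjoint. Its formula on `K₁` is
the identity `∫ (w ∘ σ) f d(λR) = ∫ w R(f) dλ` (`inner_sHat`), and it vanishes on the complement of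
`H_{K₁}` because `Ŝ` has its range in `H_{K₁}`.

For uniqueness of `Ŝ`, every class has a representative over a probability measure. For uniqueness
of `R̂`, `H_{K₁}` is exactly the union of the `H(μ)` with `μ ∈ K₁`
(`exists_isClass_of_mem_closedSpan`), so the formula determines the map there without any
continuity. -/

namespace UHS

open ProbabilityTheory

/-! ### The kernel of a transfer operator -/

namespace TransferOperator

variable {X : Type*} [MeasurableSpace X]

theorem act_dirac_apply (T : TransferOperator X) (x : X) {A : Set X} (hA : MeasurableSet A) :
    T.act (Measure.dirac x) A = ENNReal.ofReal ((T.R (indic A hA)).1 x) := by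
  rw [T.act_apply _ hA, lintegral_dirac' _ (T.R (indic A hA)).2.ennreal_ofReal]

/-- The kernel `x ↦ δ_x R` that represents a transfer operator. -/
noncomputable def fiber (T : TransferOperator X) : Kernel X X where
  toFun x := T.act (Measure.dirac x)
  measurable' := Measure.measurable_of_measurable_coe _ fun A hA => by
    simp only [T.act_dirac_apply _ hA]
    exact (T.R (indic A hA)).2.ennreal_ofReal

theorem fiber_apply (T : TransferOperator X) (x : X) {A : Set X} (hA : MeasurableSet A) :
    T.fiber x A = ENNReal.ofReal ((T.R (indic A hA)).1 x) :=
  T.act_dirac_apply x hA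

theorem act_eq_bind (T : TransferOperator X) (μ : Measure X) : T.act μ = μ.bind T.fiber := by
  ext A hA
  rw [T.act_apply _ hA, Measure.bind_apply hA T.fiber.aemeasurable]
  simp only [T.fiber_apply _ hA]

instance (T : TransferOperator X) (x : X) : IsFiniteMeasure (T.fiber x) :=
  ⟨by rw [T.fiber_apply x MeasurableSet.univ]; exact ENNReal.ofReal_lt_top⟩

theorem fiber_real (T : TransferOperator X) (x : X) {A : Set X} (hA : MeasurableSet A) :
    (T.fiber x).real A = (T.R (indic A hA)).1 x := by
  rw [measureReal_def, T.fiber_apply x hA, ENNReal.toReal_ofReal]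
  exact T.nonneg _ (fun y => Set.indicator_nonneg (fun _ _ => zero_le_one) _) x

theorem indic_univ : indic Set.univ MeasurableSet.univ = oneFun X := by
  ext x; simp [indic, oneFun]

theorem R_one_apply (T : TransferOperator X) (x : X) :
    (T.R (oneFun X)).1 x = (T.fiber x).real Set.univ := by
  rw [T.fiber_real x MeasurableSet.univ, indic_univ]

theorem R_simpleFunc (T : TransferOperator X) (s : SimpleFunc X ℝ) (x : X) :
    (T.R ⟨s, s.measurable⟩).1 x = ∫ y, s y ∂T.fiber x := by
  induction s using SimpleFunc.induction with
  | const c hs =>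
    rename_i s
    have h : (⟨_, (SimpleFunc.piecewise s hs (SimpleFunc.const X c)
        (SimpleFunc.const X 0)).measurable⟩ : BorelFun X) = c • indic s hs := by
      ext y
      by_cases hy : y ∈ s <;> simp [indic, hy]
    have h' : ∀ y, (SimpleFunc.piecewise s hs (SimpleFunc.const X c)
        (SimpleFunc.const X 0)) y = s.indicator (fun _ => c) y := by
      intro y
      by_cases hy : y ∈ s <;> simp [hy]
    rw [h, map_smul]
    simp only [h']
    rw [integral_indicator_const _ hs, T.fiber_real x hs, smul_eq_mul, mul_comm]
    rfl
  | add hd hf hg =>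
    rename_i f g
    have h : (⟨_, (f + g).measurable⟩ : BorelFun X) =
        ⟨f, f.measurable⟩ + ⟨g, g.measurable⟩ := rfl
    rw [h, map_add]
    simp only [SimpleFunc.coe_add, Pi.add_apply]
    rw [integral_add (SimpleFunc.integrable_of_isFiniteMeasure f)
      (SimpleFunc.integrable_of_isFiniteMeasure g), ← hf, ← hg]
    rfl

/-- Round `f` down to the grid `εℤ`; boundedness leaves only finitely many grid values. -/
theorem exists_simpleFunc_near (f : X → ℝ) (hf : Measurable f) {M : ℝ} (hM : ∀ x, |f x| ≤ M)
    {ε : ℝ} (hε : 0 < ε) : ∃ s : SimpleFunc X ℝ, ∀ x, |f x - s x| ≤ ε := by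
  let k : X → ℤ := fun x => ⌊f x / ε⌋
  have hk : Measurable k := Int.measurable_floor.comp (hf.div_const ε)
  have hkfin : (Set.range k).Finite := by
    refine (Set.finite_Icc ⌊-M / ε⌋ ⌊M / ε⌋).subset ?_
    rintro _ ⟨x, rfl⟩
    have := abs_le.1 (hM x)
    exact ⟨Int.floor_le_floor (by gcongr; exact this.1),
      Int.floor_le_floor (by gcongr; exact this.2)⟩
  let s : SimpleFunc X ℤ := ⟨k, fun n => hk (measurableSet_singleton n), hkfin⟩
  refine ⟨s.map fun n : ℤ => ε * (n : ℝ), fun x => ?_⟩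
  change |f x - ε * (⌊f x / ε⌋ : ℝ)| ≤ ε
  have h1 := Int.floor_le (f x / ε)
  have h2 := Int.lt_floor_add_one (f x / ε)
  rw [le_div_iff₀ hε] at h1
  rw [div_lt_iff₀ hε] at h2
  rw [abs_le]
  constructor <;> linarith

theorem abs_R_sub_le (T : TransferOperator X) (f g : BorelFun X) {ε : ℝ}
    (h : ∀ x, |f.1 x - g.1 x| ≤ ε) (x : X) :
    |(T.R f).1 x - (T.R g).1 x| ≤ ε * (T.fiber x).real Set.univ := by
  have h1 := T.mono (f := f - g) (g := ε • oneFun X)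
    (fun y => by simpa [oneFun] using (abs_le.1 (h y)).2) x
  have h2 := T.mono (f := g - f) (g := ε • oneFun X)
    (fun y => by
      have := (abs_le.1 (h y)).1
      simp [oneFun]; linarith) x
  rw [map_sub, map_smul] at h1 h2
  rw [← T.R_one_apply, abs_le]
  change (T.R f).1 x - (T.R g).1 x ≤ ε * (T.R (oneFun X)).1 x at h1
  change (T.R g).1 x - (T.R f).1 x ≤ ε * (T.R (oneFun X)).1 x at h2
  constructor <;> linarith

/-- At a fixed `x` both sides are Lipschitz for the sup norm, with constant the mass of `fiber x`,
and they agree on simple functions, which are uniformly dense in the bounded ones. -/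
theorem R_of_bounded (T : TransferOperator X) (f : BorelFun X) {M : ℝ} (hM : ∀ x, |f.1 x| ≤ M)
    (x : X) : (T.R f).1 x = ∫ y, f.1 y ∂T.fiber x := by
  set C := (T.fiber x).real Set.univ with hC
  have hC0 : 0 ≤ C := measureReal_nonneg
  have hfi : Integrable f.1 (T.fiber x) :=
    Integrable.of_bound f.2.aestronglyMeasurable M (Eventually.of_forall hM)
  have key : ∀ ε > 0, |(T.R f).1 x - ∫ y, f.1 y ∂T.fiber x| ≤ ε * (2 * C) := by
    intro ε hε
    obtain ⟨s, hs⟩ := exists_simpleFunc_near f.1 f.2 hM hε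
    have h1 := T.abs_R_sub_le f ⟨s, s.measurable⟩ hs x
    have h2 : |∫ y, f.1 y ∂T.fiber x - ∫ y, s y ∂T.fiber x| ≤ ε * C := by
      rw [← integral_sub hfi (SimpleFunc.integrable_of_isFiniteMeasure s)]
      exact norm_integral_le_of_norm_le_const (f := fun y => f.1 y - s y) (Eventually.of_forall hs)
    rw [T.R_simpleFunc] at h1
    rw [abs_le] at *
    constructor <;> linarith
  have h0 : |(T.R f).1 x - ∫ y, f.1 y ∂T.fiber x| ≤ 0 := by
    refine le_of_forall_pos_le_add fun δ hδ => ?_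
    -- The `+ 1` keeps the denominator positive when `C = 0`.
    have := key (δ / (2 * C + 1)) (by positivity)
    refine this.trans ?_
    rw [zero_add, div_mul_eq_mul_div, div_le_iff₀ (by positivity)]
    nlinarith
  exact sub_eq_zero.1 (abs_nonpos_iff.1 h0)

/-- On nonnegative Borel functions a transfer operator is integration against its kernel. -/
theorem lintegral_fiber (T : TransferOperator X) (f : BorelFun X) (hf : ∀ x, 0 ≤ f.1 x) (x : X) :
    ∫⁻ y, ENNReal.ofReal (f.1 y) ∂T.fiber x = ENNReal.ofReal ((T.R f).1 x) := by
  have hA : ∀ n : ℕ, MeasurableSet {y | f.1 y < n} := fun n => f.2 measurableSet_Iio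
  let g : ℕ → BorelFun X := fun n => ⟨{y | f.1 y < n}.indicator f.1, f.2.indicator (hA n)⟩
  have hg0 : ∀ n y, 0 ≤ (g n).1 y := fun n => Set.indicator_nonneg fun y _ => hf y
  have hgM : ∀ n y, |(g n).1 y| ≤ n := by
    intro n y
    rw [abs_of_nonneg (hg0 n y)]
    exact Set.indicator_le' (s := {y | f.1 y < n}) (g := fun _ => (n : ℝ))
      (fun y hy => le_of_lt hy) (fun _ _ => n.cast_nonneg) y
  have hgR : ∀ n, ∫⁻ y, ENNReal.ofReal ((g n).1 y) ∂T.fiber x =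
      ENNReal.ofReal ((T.R (g n)).1 x) := by
    intro n
    rw [T.R_of_bounded (g n) (hgM n), ofReal_integral_eq_lintegral_ofReal
      (Integrable.of_bound (g n).2.aestronglyMeasurable n (Eventually.of_forall (hgM n)))
      (Eventually.of_forall (hg0 n))]
  -- The truncation error `f - g n` lives where `f ≥ n`, so `n (f - g n) ≤ f ^ 2`. Since `R (f ^ 2)
  -- x` is a finite number, positivity gives `R (g n) x → R f x` with error at most `R (f ^ 2) x /
  -- n`.
  let F : BorelFun X := ⟨fun y => f.1 y ^ 2, f.2.pow_const 2⟩
  have hle : ∀ n y, (g n).1 y ≤ f.1 y := fun n y => Set.indicator_le_self' (fun y _ => hf y) y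
  have htail : ∀ (n : ℕ) y, (n : ℝ) * (f.1 y - (g n).1 y) ≤ F.1 y := by
    intro n y
    by_cases hy : f.1 y < n
    · have : (g n).1 y = f.1 y := Set.indicator_of_mem (s := {y | f.1 y < n}) hy _
      rw [this, sub_self, mul_zero]
      exact sq_nonneg _
    · have : (g n).1 y = 0 := Set.indicator_of_notMem (s := {y | f.1 y < n}) hy _
      rw [this]
      change (n : ℝ) * (f.1 y - 0) ≤ f.1 y ^ 2
      have := hf y
      nlinarith [not_lt.1 hy]
  have hlim : Tendsto (fun n => (T.R (g n)).1 x) atTop (nhds ((T.R f).1 x)) := by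
    have h3 : Tendsto (fun n : ℕ => (T.R f).1 x - (T.R F).1 x / n) atTop
        (nhds ((T.R f).1 x)) := by
      simpa using tendsto_const_nhds.sub (tendsto_const_div_atTop_nhds_zero_nat ((T.R F).1 x))
    refine tendsto_of_tendsto_of_tendsto_of_le_of_le' h3 tendsto_const_nhds ?_
      (Eventually.of_forall fun n => T.mono (hle n) x)
    filter_upwards [eventually_gt_atTop 0] with n hn
    have hn' : (0 : ℝ) < n := by exact_mod_cast hn
    have := T.mono (f := (n : ℝ) • (f - g n)) (g := F) (htail n) x
    rw [map_smul, map_sub] at this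
    change (n : ℝ) * ((T.R f).1 x - (T.R (g n)).1 x) ≤ (T.R F).1 x at this
    rw [sub_le_comm, le_div_iff₀ hn']
    linarith
  have h1 : Tendsto (fun n => ∫⁻ y, ENNReal.ofReal ((g n).1 y) ∂T.fiber x) atTop
      (nhds (∫⁻ y, ENNReal.ofReal (f.1 y) ∂T.fiber x)) := by
    refine lintegral_tendsto_of_tendsto_of_monotone
      (fun n => (g n).2.ennreal_ofReal.aemeasurable) (Eventually.of_forall fun y => ?_)
      (Eventually.of_forall fun y => ?_)
    · intro m n hmn
      refine ENNReal.ofReal_le_ofReal ?_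
      refine Set.indicator_le_indicator_of_subset (fun z hz => ?_) hf y
      exact lt_of_lt_of_le (show f.1 z < m from hz) (by exact_mod_cast hmn)
    · refine tendsto_const_nhds.congr' ?_
      obtain ⟨N, hN⟩ := exists_nat_gt (f.1 y)
      filter_upwards [eventually_ge_atTop N] with n hn
      have hy : f.1 y < n := hN.trans_le (by exact_mod_cast hn)
      exact congrArg _ (Set.indicator_of_mem (s := {y | f.1 y < n}) hy _).symm
  refine tendsto_nhds_unique h1 ?_
  simp only [hgR]
  exact (ENNReal.continuous_ofReal.tendsto _).comp hlim

/-- The integral of `|f|` is `R |f| x`, a real number. -/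
theorem integrable_fiber (T : TransferOperator X) (f : BorelFun X) (x : X) :
    Integrable f.1 (T.fiber x) := by
  refine ⟨f.2.aestronglyMeasurable, ?_⟩
  rw [hasFiniteIntegral_iff_norm]
  have := T.lintegral_fiber ⟨fun y => ‖f.1 y‖, f.2.norm⟩ (fun y => norm_nonneg _) x
  exact this.trans_lt ENNReal.ofReal_lt_top

/-- A transfer operator is integration against its kernel. -/
theorem R_eq_integral (T : TransferOperator X) (f : BorelFun X) (x : X) :
    (T.R f).1 x = ∫ y, f.1 y ∂T.fiber x := by
  let fp : BorelFun X := ⟨fun y => max (f.1 y) 0, f.2.max measurable_const⟩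
  let fm : BorelFun X := ⟨fun y => max (-f.1 y) 0, f.2.neg.max measurable_const⟩
  have hpos : ∀ g : BorelFun X, (∀ y, 0 ≤ g.1 y) → (T.R g).1 x = ∫ y, g.1 y ∂T.fiber x := by
    intro g hg
    rw [integral_eq_lintegral_of_nonneg_ae (Eventually.of_forall hg) g.2.aestronglyMeasurable,
      T.lintegral_fiber g hg, ENNReal.toReal_ofReal (T.nonneg g hg x)]
  have h : f = fp - fm := by
    ext y
    exact (max_zero_sub_eq_self (f.1 y)).symm
  have h1 : (T.R f).1 x = (T.R fp).1 x - (T.R fm).1 x := by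
    conv_lhs => rw [h, map_sub]
    rfl
  rw [h1, hpos fp fun y => le_max_right _ _, hpos fm fun y => le_max_right _ _,
    ← integral_sub (T.integrable_fiber fp x) (T.integrable_fiber fm x)]
  exact integral_congr_ae (Eventually.of_forall fun y => max_zero_sub_eq_self (f.1 y))

/-! ### Integration against `μR`, fibres and `L²` bounds -/

theorem lintegral_act (T : TransferOperator X) (μ : Measure X) {g : X → ℝ≥0∞} (hg : Measurable g) :
    ∫⁻ y, g y ∂T.act μ = ∫⁻ x, ∫⁻ y, g y ∂T.fiber x ∂μ := by
  rw [act_eq_bind, Measure.lintegral_bind T.fiber.aemeasurable hg.aemeasurable]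

theorem integral_act (T : TransferOperator X) (μ : Measure X) (f : BorelFun X)
    (hf : Integrable f.1 (T.act μ)) : ∫ y, f.1 y ∂T.act μ = ∫ x, (T.R f).1 x ∂μ := by
  rw [act_eq_bind] at hf ⊢
  -- Reading `μ` as a kernel from a point turns `μR` into a kernel composition, for which Fubini is
  -- available.
  have h : (T.fiber ∘ₖ Kernel.const Unit μ) () = μ.bind T.fiber := by
    rw [Kernel.comp_apply, Kernel.const_apply]
  rw [← h] at hf ⊢
  rw [Kernel.integral_comp hf, Kernel.const_apply]
  simp only [T.R_eq_integral]

theorem Normalized.isProbabilityMeasure_fiber {T : TransferOperator X} (hT : T.Normalized)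
    (x : X) : IsProbabilityMeasure (T.fiber x) :=
  ⟨by rw [T.fiber_apply x MeasurableSet.univ, indic_univ, hT]; simp [oneFun]⟩

/-- Pull-out applied to the indicator of `{x}ᶜ` and to `1` gives `R (1_{σ⁻¹{x}ᶜ}) = 1_{{x}ᶜ} R(1)`,
which vanishes at `x`. -/
theorem ae_fiber [MeasurableSingletonClass X] (T : TransferOperator X) (x : X) :
    ∀ᵐ y ∂T.fiber x, T.σ y = x := by
  have hA : MeasurableSet (T.σ ⁻¹' {x}ᶜ) := T.measurable_σ (measurableSet_singleton x).compl
  change T.fiber x (T.σ ⁻¹' {x}ᶜ) = 0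
  have h := T.pull_out (indic {x}ᶜ (measurableSet_singleton x).compl) (oneFun X)
  have h' : (⟨fun y => (indic {x}ᶜ (measurableSet_singleton x).compl).1 (T.σ y) * (oneFun X).1 y,
      ((indic {x}ᶜ (measurableSet_singleton x).compl).2.comp T.measurable_σ).mul
        (oneFun X).2⟩ : BorelFun X) = indic _ hA := by
    ext y
    by_cases hy : T.σ y = x <;> simp [indic, oneFun, hy]
  rw [h'] at h
  rw [T.fiber_apply x hA, h]
  simp [indic]

/-- Jensen's inequality: freeze the number `c = R f x`, apply positivity to `(f - c) ^ 2` and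
evaluate at `x`, using `R(1) = 1`. -/
theorem R_sq_le {T : TransferOperator X} (hT : T.Normalized) (f : BorelFun X) (x : X) :
    (T.R f).1 x ^ 2 ≤ (T.R ⟨fun y => f.1 y ^ 2, f.2.pow_const 2⟩).1 x := by
  set c := (T.R f).1 x with hc
  set F : BorelFun X := ⟨fun y => f.1 y ^ 2, f.2.pow_const 2⟩
  have h := T.nonneg (F - (2 * c) • f + c ^ 2 • oneFun X) (fun y => by
    have : 0 ≤ (f.1 y - c) ^ 2 := sq_nonneg _
    change 0 ≤ f.1 y ^ 2 - (2 * c) * f.1 y + c ^ 2 * 1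
    linarith) x
  rw [map_add, map_sub, map_smul, map_smul, hT] at h
  change 0 ≤ (T.R F).1 x - (2 * c) * (T.R f).1 x + c ^ 2 * 1 at h
  rw [← hc] at h
  linarith

theorem act_ac (T : TransferOperator X) {μ ν : Measure X} (h : μ ≪ ν) : T.act μ ≪ T.act ν := by
  refine Measure.AbsolutelyContinuous.mk fun A hA h0 => ?_
  rw [act_eq_bind, Measure.bind_apply hA T.fiber.aemeasurable,
    lintegral_eq_zero_iff (T.fiber.measurable_coe hA)] at h0 ⊢
  exact h.ae_le h0

theorem memLp_R {T : TransferOperator X} (hT : T.Normalized) {ν : Measure X} (f : BorelFun X)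
    (hf : MemLp f.1 2 (T.act ν)) : MemLp (T.R f).1 2 ν := by
  rw [memLp_two_iff_integrable_sq (T.R f).2.aestronglyMeasurable]
  let F : BorelFun X := ⟨fun y => f.1 y ^ 2, f.2.pow_const 2⟩
  have hF : ∀ y, 0 ≤ F.1 y := fun y => sq_nonneg _
  have h : Integrable F.1 (T.act ν) := hf.integrable_sq
  have h1 : Integrable (T.R F).1 ν := by
    refine ⟨(T.R F).2.aestronglyMeasurable, ?_⟩
    have h2 := h.2
    rw [hasFiniteIntegral_iff_ofReal (Eventually.of_forall hF),
      T.lintegral_act ν F.2.ennreal_ofReal] at h2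
    rw [hasFiniteIntegral_iff_ofReal (Eventually.of_forall (T.nonneg F hF))]
    simpa only [T.lintegral_fiber F hF] using h2
  refine h1.mono' ((T.R f).2.pow_const 2).aestronglyMeasurable (Eventually.of_forall fun x => ?_)
  rw [Real.norm_of_nonneg (sq_nonneg _)]
  exact R_sq_le hT f x

/-! ### How `μR` relates to `σ` -/

section Action

variable [MeasurableSingletonClass X]

/-- `fiber x` is a probability measure carried by `σ⁻¹{x}`, so it gives `σ⁻¹ A` the mass `1_A(x)`.
-/
theorem measurePreserving_act {T : TransferOperator X} (hT : T.Normalized) (μ : Measure X) :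
    MeasurePreserving T.σ (T.act μ) μ := by
  refine ⟨T.measurable_σ, ?_⟩
  ext A hA
  have := hT.isProbabilityMeasure_fiber
  rw [Measure.map_apply T.measurable_σ hA, act_eq_bind,
    Measure.bind_apply (T.measurable_σ hA) T.fiber.aemeasurable, ← lintegral_indicator_one hA]
  refine lintegral_congr fun x => ?_
  rw [← lintegral_indicator_one (T.measurable_σ hA)]
  calc _ = ∫⁻ _, A.indicator 1 x ∂T.fiber x := by
        refine lintegral_congr_ae ?_
        filter_upwards [T.ae_fiber x] with y hy
        by_cases hx : x ∈ A <;> simp [hy, hx]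
    _ = _ := by simp

/-- Preimages under `σ` of sets exhausting `μ` exhaust `μR`. -/
theorem sigmaFinite_act {T : TransferOperator X} (hT : T.Normalized) (μ : Measure X)
    [SigmaFinite μ] : SigmaFinite (T.act μ) :=
  SigmaFinite.of_map _ T.measurable_σ.aemeasurable
    (by rw [(measurePreserving_act hT μ).map_eq]; infer_instance)

/-- On `fiber x` the function `h ∘ σ` is almost everywhere the constant `h x`, so it moves through
the inner integral. -/
theorem act_withDensity (T : TransferOperator X) (μ : Measure X) {h : X → ℝ≥0∞}
    (hh : Measurable h) :
    T.act (μ.withDensity h) = (T.act μ).withDensity (h ∘ T.σ) := by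
  ext A hA
  rw [withDensity_apply _ hA, ← lintegral_indicator hA,
    T.lintegral_act _ ((hh.comp T.measurable_σ).indicator hA), act_eq_bind,
    Measure.bind_apply hA T.fiber.aemeasurable,
    lintegral_withDensity_eq_lintegral_mul _ hh (T.fiber.measurable_coe hA)]
  refine lintegral_congr fun x => ?_
  rw [Pi.mul_apply, ← lintegral_indicator_one hA,
    ← lintegral_const_mul _ (measurable_one.indicator hA)]
  refine lintegral_congr_ae ?_
  filter_upwards [T.ae_fiber x] with y hy
  by_cases hyA : y ∈ A <;> simp [hyA, hy]

theorem rnDeriv_act {T : TransferOperator X} (hT : T.Normalized) {μ ν : Measure X}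
    [SigmaFinite μ] [SigmaFinite ν] (h : μ ≪ ν) :
    (T.act μ).rnDeriv (T.act ν) =ᵐ[T.act ν] μ.rnDeriv ν ∘ T.σ := by
  have := sigmaFinite_act hT ν
  conv_lhs => rw [← Measure.withDensity_rnDeriv_eq μ ν h,
    T.act_withDensity ν (Measure.measurable_rnDeriv μ ν)]
  exact Measure.rnDeriv_withDensity _ ((Measure.measurable_rnDeriv μ ν).comp T.measurable_σ)

end Action

end TransferOperator

/-! ### Representatives of classes and the embeddings of `L²` -/

section UniversalHilbert

variable {X : Type*} [MeasurableSpace X]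

namespace Pair

theorem dens_self (p : Pair X) : p.dens p.μ =ᵐ[p.μ] p.f := by
  filter_upwards [Measure.rnDeriv_self p.μ] with x hx
  simp [dens, hx]

/-- The representative `(f √(dμ/dlam), lam)` of the class of `(f, μ)`. -/
noncomputable def transport (p : Pair X) (lam : Measure X) [SigmaFinite lam] (h : p.μ ≪ lam) :
    Pair X where
  f := p.dens lam
  μ := lam
  sigmaFinite := inferInstance
  measurable := p.measurable_dens lam
  memLp := p.memLp_dens h

theorem mk_transport (p : Pair X) (lam : Measure X) [SigmaFinite lam] (h : p.μ ≪ lam) :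
    UniversalHilbert.mk (p.transport lam h) = UniversalHilbert.mk p :=
  (UniversalHilbert.mk_eq_mk Measure.AbsolutelyContinuous.rfl h).2 (p.transport lam h).dens_self

end Pair

namespace UniversalHilbert

theorem IsClass.unique {v w : UniversalHilbert X} {f : X → ℝ} {μ : Measure X}
    (hv : v.IsClass f μ) (hw : w.IsClass f μ) : v = w := by
  obtain ⟨⟨f₁, μ₁, _, _, _⟩, rfl, rfl, rfl⟩ := hv
  obtain ⟨⟨f₂, μ₂, _, _, _⟩, h1, h2, rfl⟩ := hw
  dsimp only at h1 h2
  subst h1 h2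
  rfl

theorem isClass_transport (p : Pair X) (lam : Measure X) [SigmaFinite lam] (h : p.μ ≪ lam) :
    (mk p).IsClass (p.dens lam) lam := ⟨p.transport lam h, rfl, rfl, p.mk_transport lam h⟩

/-- An empty space carries no probability measure, so this case is split off; there all the claims
are trivial. -/
instance [IsEmpty X] : Subsingleton (UniversalHilbert X) :=
  ⟨fun u v => by
    obtain ⟨p, rfl⟩ := mk_surj u
    obtain ⟨q, rfl⟩ := mk_surj v
    rw [mk_eq_mk (Pair.ac_left p.μ q.μ) (Pair.ac_right p.μ q.μ)]
    exact Eventually.of_forall isEmptyElim⟩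

theorem exists_isProbabilityMeasure_ac [Nonempty X] (μ : Measure X) [SFinite μ] :
    ∃ ν : Measure X, IsProbabilityMeasure ν ∧ μ ≪ ν := by
  -- The Dirac mass guards against `μ = 0`: `toFinite` is a probability measure only for a nonzero
  -- measure.
  let κ : Measure X := μ + Measure.dirac (Classical.arbitrary X)
  have : NeZero κ := ⟨fun h => by
    have := congrArg (fun m : Measure X => m Set.univ) h
    simp [κ] at this⟩
  exact ⟨κ.toFinite, inferInstance, (Pair.ac_left _ _).trans (absolutelyContinuous_toFinite κ)⟩

theorem exists_isClass [Nonempty X] (v : UniversalHilbert X) :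
    ∃ (f : X → ℝ) (μ : Measure X), IsProbabilityMeasure μ ∧ v.IsClass f μ := by
  obtain ⟨p, rfl⟩ := mk_surj v
  obtain ⟨ν, hν, h⟩ := exists_isProbabilityMeasure_ac p.μ
  exact ⟨_, ν, hν, isClass_transport p ν h⟩

section ofLp

variable {lam : Measure X} [SigmaFinite lam]

/-- A pair representing an element of `L²(lam)`. -/
noncomputable def pairOfLp (G : Lp ℝ 2 lam) : Pair X where
  f := (Lp.aestronglyMeasurable G).aemeasurable.mk G
  μ := lam
  sigmaFinite := inferInstance
  measurable := (Lp.aestronglyMeasurable G).aemeasurable.measurable_mk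
  memLp := (memLp_congr_ae (Lp.aestronglyMeasurable G).aemeasurable.ae_eq_mk).1 (Lp.memLp G)

theorem dens_pairOfLp (G : Lp ℝ 2 lam) : (pairOfLp G).dens lam =ᵐ[lam] G :=
  (pairOfLp G).dens_self.trans (Lp.aestronglyMeasurable G).aemeasurable.ae_eq_mk.symm

theorem pairOfLp_ac (G : Lp ℝ 2 lam) : (pairOfLp G).μ ≪ lam := Measure.AbsolutelyContinuous.rfl

variable (lam) in
/-- The isometric embedding `f ↦ f √dlam` of `L²(lam)`. -/
noncomputable def ofLp : Lp ℝ 2 lam →ₗᵢ[ℝ] UniversalHilbert X :=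
  LinearMap.isometryOfInner
    { toFun := fun G => mk (pairOfLp G)
      map_add' := fun F G => by
        rw [mk_add, mk_eq_mk (pairOfLp_ac _) (Pair.add_ac _ _ (pairOfLp_ac F) (pairOfLp_ac G))]
        filter_upwards [Pair.dens_add _ _ (pairOfLp_ac F) (pairOfLp_ac G), dens_pairOfLp F,
          dens_pairOfLp G, dens_pairOfLp (F + G), Lp.coeFn_add F G] with x h1 h2 h3 h4 h5
        rw [h1, h2, h3, h4, h5, Pi.add_apply]
      map_smul' := fun c G => by
        rw [RingHom.id_apply, mk_smul, mk_eq_mk (pairOfLp_ac _) (smul_ac c _ (pairOfLp_ac G))]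
        filter_upwards [dens_pairOfLp G, dens_pairOfLp (c • G), Lp.coeFn_smul c G] with x h1 h2 h3
        rw [Pair.dens_smul, h1, h2, h3, Pi.smul_apply, smul_eq_mul] }
    (fun F G => by
      change inner ℝ (mk (pairOfLp F)) (mk (pairOfLp G)) = _
      rw [inner_mk _ _ (pairOfLp_ac F) (pairOfLp_ac G), L2.inner_def]
      apply integral_congr_ae
      filter_upwards [dens_pairOfLp F, dens_pairOfLp G] with x h1 h2
      rw [h1, h2, RCLike.inner_apply, conj_trivial, mul_comm])

theorem mem_range_ofLp (v : UniversalHilbert X) :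
    v ∈ LinearMap.range (ofLp lam).toLinearMap ↔ ∃ f, v.IsClass f lam := by
  constructor
  · rintro ⟨G, rfl⟩
    exact ⟨_, pairOfLp G, rfl, rfl, rfl⟩
  · rintro ⟨f, p, rfl, rfl, rfl⟩
    refine ⟨p.memLp.toLp, (mk_eq_mk (pairOfLp_ac _) Measure.AbsolutelyContinuous.rfl).2 ?_⟩
    exact (dens_pairOfLp _).trans (p.memLp.coeFn_toLp.trans p.dens_self.symm)

/-- An isometric image of the complete space `L²(lam)` is closed; limits of sequences over one
measure stay over that measure. -/
theorem isClosed_range_ofLp :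
    IsClosed (LinearMap.range (ofLp lam).toLinearMap : Set (UniversalHilbert X)) := by
  rw [LinearMap.coe_range]
  exact (ofLp lam).isometry.isClosedEmbedding.isClosed_range

end ofLp

end UniversalHilbert

open UniversalHilbert

/-- Every class is `f√dμ` with `μ` a probability measure, so the formula fixes every value; neither
linearity nor continuity enters. -/
theorem TransferOperator.IsSHat.unique {T : TransferOperator X}
    {S₁ S₂ : UniversalHilbert X → UniversalHilbert X} (h₁ : T.IsSHat S₁)
    (h₂ : T.IsSHat S₂) : S₁ = S₂ := by
  funext v
  cases isEmpty_or_nonempty X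
  · exact Subsingleton.elim _ _
  · obtain ⟨f, μ, hμ, hv⟩ := exists_isClass v
    exact (h₁ v f μ hμ hv).unique (h₂ v f μ hμ hv)

/-! ### The isometry `Ŝ` -/

section SHat

variable [MeasurableSingletonClass X] {T : TransferOperator X}

namespace Pair

/-- The pair `(f ∘ σ, μR)`. -/
noncomputable def pullback (hT : T.Normalized) (p : Pair X) : Pair X where
  f := p.f ∘ T.σ
  μ := T.act p.μ
  sigmaFinite := TransferOperator.sigmaFinite_act hT p.μ
  measurable := p.measurable.comp T.measurable_σ
  memLp := p.memLp.comp_measurePreserving (TransferOperator.measurePreserving_act hT p.μ)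

theorem dens_pullback (hT : T.Normalized) (p : Pair X) {lam : Measure X} [SigmaFinite lam]
    (h : p.μ ≪ lam) :
    (p.pullback hT).dens (T.act lam) =ᵐ[T.act lam] p.dens lam ∘ T.σ := by
  filter_upwards [TransferOperator.rnDeriv_act hT h] with x hx
  simp only [dens, pullback, hx, Function.comp_apply]

theorem pullback_ac (hT : T.Normalized) (p : Pair X) {lam : Measure X} (h : p.μ ≪ lam) :
    (p.pullback hT).μ ≪ T.act lam := T.act_ac h

end Pair

namespace TransferOperator

/-- Densities relative to `lam R` are those relative to `lam` composed with `σ`, and `σ` pulls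
`lam`-null sets back to `lam R`-null sets. -/
theorem mk_pullback_congr (hT : T.Normalized) {p q : Pair X} {lam : Measure X}
    [SigmaFinite lam] (hp : p.μ ≪ lam) (hq : q.μ ≪ lam) (h : p.dens lam =ᵐ[lam] q.dens lam) :
    UniversalHilbert.mk (p.pullback hT) = UniversalHilbert.mk (q.pullback hT) := by
  have := sigmaFinite_act hT lam
  rw [mk_eq_mk (p.pullback_ac hT hp) (q.pullback_ac hT hq)]
  exact (p.dens_pullback hT hp).trans
    (((measurePreserving_act hT lam).quasiMeasurePreserving.ae_eq_comp h).trans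
      (q.dens_pullback hT hq).symm)

/-- The map `f √dμ ↦ (f ∘ σ) √d(μR)`. -/
noncomputable def sHatFun (hT : T.Normalized) : UniversalHilbert X → UniversalHilbert X :=
  Quotient.lift (fun p => UniversalHilbert.mk (p.pullback hT)) (fun p q h =>
    mk_pullback_congr hT (Pair.ac_left p.μ q.μ) (Pair.ac_right p.μ q.μ)
      (rel_dens h (Pair.ac_left _ _) (Pair.ac_right _ _)))

theorem sHatFun_mk (hT : T.Normalized) (p : Pair X) :
    sHatFun hT (UniversalHilbert.mk p) = UniversalHilbert.mk (p.pullback hT) := rfl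

/-- The isometry `Ŝ`. -/
noncomputable def sHat (hT : T.Normalized) : UniversalHilbert X →ₗᵢ[ℝ] UniversalHilbert X :=
  LinearMap.isometryOfInner
    { toFun := sHatFun hT
      map_add' := fun u v => by
        obtain ⟨p, rfl⟩ := mk_surj u
        obtain ⟨q, rfl⟩ := mk_surj v
        have a1 := Pair.ac_left p.μ q.μ
        have a2 := Pair.ac_right p.μ q.μ
        have := sigmaFinite_act hT (p.μ + q.μ)
        rw [mk_add, sHatFun_mk, sHatFun_mk, sHatFun_mk, mk_add,
          mk_eq_mk (Pair.pullback_ac hT _ (Pair.add_ac _ _ a1 a2))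
            (Pair.add_ac _ _ (p.pullback_ac hT a1) (q.pullback_ac hT a2))]
        filter_upwards [Pair.dens_add _ _ (p.pullback_ac hT a1) (q.pullback_ac hT a2),
          p.dens_pullback hT a1, q.dens_pullback hT a2,
          (p.add q).dens_pullback hT (Pair.add_ac _ _ a1 a2),
          (measurePreserving_act hT (p.μ + q.μ)).quasiMeasurePreserving.ae (Pair.dens_add _ _ a1 a2)]
          with x h1 h2 h3 h4 h5
        rw [h1, h2, h3, h4, Function.comp_apply, h5]
        rfl
      map_smul' := fun c u => by
        obtain ⟨p, rfl⟩ := mk_surj u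
        rfl }
    (fun u v => by
      obtain ⟨p, rfl⟩ := mk_surj u
      obtain ⟨q, rfl⟩ := mk_surj v
      have a1 := Pair.ac_left p.μ q.μ
      have a2 := Pair.ac_right p.μ q.μ
      have := sigmaFinite_act hT (p.μ + q.μ)
      have hm := measurePreserving_act hT (p.μ + q.μ)
      change inner ℝ (UniversalHilbert.mk (p.pullback hT)) (UniversalHilbert.mk (q.pullback hT)) = _
      -- Change of variables along `σ`, which preserves measure: this is why `Ŝ` is isometric.
      have hc : ∫ x, p.dens (p.μ + q.μ) (T.σ x) * q.dens (p.μ + q.μ) (T.σ x)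
          ∂T.act (p.μ + q.μ) = ∫ x, p.dens (p.μ + q.μ) x * q.dens (p.μ + q.μ) x ∂(p.μ + q.μ) := by
        have h := integral_map (μ := T.act (p.μ + q.μ)) T.measurable_σ.aemeasurable
          (f := fun x => p.dens (p.μ + q.μ) x * q.dens (p.μ + q.μ) x)
          ((p.measurable_dens _).mul (q.measurable_dens _)).aestronglyMeasurable
        rw [← h, hm.map_eq]
      rw [inner_mk _ _ (p.pullback_ac hT a1) (q.pullback_ac hT a2), inner_mk _ _ a1 a2, ← hc]
      apply integral_congr_ae
      filter_upwards [p.dens_pullback hT a1, q.dens_pullback hT a2] with x h1 h2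
      rw [h1, h2]
      rfl)

theorem sHat_isClass (hT : T.Normalized) {v : UniversalHilbert X} {f : X → ℝ} {μ : Measure X}
    (h : v.IsClass f μ) :
    (sHat hT v).IsClass (f ∘ T.σ) (T.act μ) := by
  obtain ⟨p, rfl, rfl, rfl⟩ := h
  exact ⟨p.pullback hT, rfl, rfl, rfl⟩

theorem isSHat_sHat (hT : T.Normalized) : T.IsSHat (sHat hT) := fun _ _ _ _ h => sHat_isClass hT h

/-! ### The subspace `H_{K₁}` -/

/-- `H_{K₁}` is the union of the subspaces `H(μ)`, `μ ∈ K₁`. -/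
theorem exists_isClass_of_mem_closedSpan (hT : T.Normalized) [Nonempty X] {v : UniversalHilbert X}
    (hv : v ∈ closedSpan T.K₁) : ∃ μ ∈ T.K₁, ∃ f, v.IsClass f μ := by
  let W : Set (UniversalHilbert X) := {v | ∃ μ ∈ T.K₁, ∃ f, v.IsClass f μ}
  -- Countably many measures `ν n R` are dominated by one `κR` in `K₁`: choose a probability measure
  -- `κ` dominating every `ν n`, and use that the action preserves `≪`.
  have common : ∀ u : ℕ → UniversalHilbert X, (∀ n, u n ∈ W) →
      ∃ ν : Measure X, IsProbabilityMeasure ν ∧ ∀ n, ∃ f, (u n).IsClass f (T.act ν) := by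
    intro u hu
    choose μ hμ f hf using hu
    choose ν hν hνμ using hμ
    obtain ⟨κ, hκ, hac⟩ := exists_isProbabilityMeasure_ac (Measure.sum ν)
    refine ⟨κ, hκ, fun n => ?_⟩
    obtain ⟨p, -, hp, hpu⟩ := hf n
    have := sigmaFinite_act hT κ
    have h : p.μ ≪ T.act κ := by
      rw [hp, ← hνμ n]
      exact T.act_ac ((Measure.absolutelyContinuous_sum_right n
        Measure.AbsolutelyContinuous.rfl).trans hac)
    exact ⟨_, hpu ▸ isClass_transport p _ h⟩
  -- Thus a sequence in `W` lies in a single closed subspace `H(κR) ⊆ W`. Sums, multiples and limits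
  -- therefore stay in `W`.
  have toRange : ∀ u : ℕ → UniversalHilbert X, (∀ n, u n ∈ W) →
      ∃ V : Submodule ℝ (UniversalHilbert X), IsClosed (V : Set (UniversalHilbert X)) ∧
        (∀ n, u n ∈ V) ∧ (V : Set (UniversalHilbert X)) ⊆ W := by
    intro u hu
    obtain ⟨ν, hν, h⟩ := common u hu
    have := sigmaFinite_act hT ν
    exact ⟨LinearMap.range (ofLp (T.act ν)).toLinearMap, isClosed_range_ofLp,
      fun n => (mem_range_ofLp _).2 (h n), fun w hw => ⟨_, ⟨ν, hν, rfl⟩, (mem_range_ofLp w).1 hw⟩⟩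
  have hspan : ∀ w ∈ Submodule.span ℝ W, w ∈ W := by
    intro w hw
    induction hw using Submodule.span_induction with
    | mem x hx => exact hx
    | zero =>
      have := sigmaFinite_act hT (Measure.dirac (Classical.arbitrary X))
      exact ⟨_, ⟨Measure.dirac (Classical.arbitrary X), inferInstance, rfl⟩,
        (mem_range_ofLp 0).1 (Submodule.zero_mem _)⟩
    | add x y _ _ hx hy =>
      obtain ⟨V, -, hV, hVW⟩ := toRange (fun n => if n = 0 then x else y)
        (fun n => by split_ifs <;> assumption)
      exact hVW (V.add_mem (by simpa using hV 0) (by simpa using hV 1))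
    | smul c x _ hx =>
      obtain ⟨V, -, hV, hVW⟩ := toRange (fun _ => x) fun _ => hx
      exact hVW (V.smul_mem c (hV 0))
  have hv' : v ∈ closure (Submodule.span ℝ W : Set (UniversalHilbert X)) := hv
  obtain ⟨u, hu, hlim⟩ := mem_closure_iff_seq_limit.1 hv'
  obtain ⟨V, hVc, hV, hVW⟩ := toRange u fun n => hspan _ (hu n)
  exact hVW (hVc.mem_of_tendsto hlim (Eventually.of_forall hV))

/-- Needed for the adjoint of `Ŝ` to vanish on the orthogonal complement of `H_{K₁}`. -/
theorem sHat_mem_closedSpan (hT : T.Normalized) [Nonempty X] (v : UniversalHilbert X) :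
    sHat hT v ∈ closedSpan T.K₁ := by
  obtain ⟨f, μ, hμ, hv⟩ := exists_isClass v
  exact Submodule.le_topologicalClosure _
    (Submodule.subset_span ⟨_, ⟨μ, hμ, rfl⟩, _, sHat_isClass hT hv⟩)

/-! ### The adjoint `R̂` -/

/-- Relative to `lam R`, the left integrand is `(w ∘ σ) f` with `w = p.dens lam * √(dν/dlam)`.
Integrating it against `lam R` amounts to integrating its image under `R` against `lam`, and
pull-out turns that image into `w R(f)`, the right integrand. -/
theorem inner_sHat (hT : T.Normalized) (p q r : Pair X) (ν : Measure X) [SigmaFinite ν]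
    (hq : q.μ = T.act ν)
    (hrν : r.μ = ν) (f : BorelFun X) (hqf : q.f = f.1) (hr : r.f = (T.R f).1) :
    inner ℝ (sHat hT (UniversalHilbert.mk p)) (UniversalHilbert.mk q) =
      inner ℝ (UniversalHilbert.mk p) (UniversalHilbert.mk r) := by
  let lam := p.μ + ν
  have a1 : p.μ ≪ lam := Pair.ac_left p.μ ν
  have a2 : ν ≪ lam := Pair.ac_right p.μ ν
  have ar : r.μ ≪ lam := hrν ▸ a2
  have := sigmaFinite_act hT lam
  have aq : q.μ ≪ T.act lam := hq ▸ T.act_ac a2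
  have hp := p.pullback_ac hT a1
  change inner ℝ (UniversalHilbert.mk (p.pullback hT)) (UniversalHilbert.mk q) = _
  let w : BorelFun X := ⟨fun x => p.dens lam x * √((ν.rnDeriv lam x).toReal),
    (p.measurable_dens lam).mul (Measure.measurable_rnDeriv _ _).ennreal_toReal.sqrt⟩
  let F : BorelFun X := ⟨fun x => w.1 (T.σ x) * f.1 x, (w.2.comp T.measurable_σ).mul f.2⟩
  have hF : (fun x => (p.pullback hT).dens (T.act lam) x * q.dens (T.act lam) x)
      =ᵐ[T.act lam] F.1 := by
    filter_upwards [p.dens_pullback hT a1, rnDeriv_act hT a2] with x h1 h2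
    rw [h1]
    simp only [Pair.dens, hq, hqf, h2, F, w, Function.comp_apply]
    ring
  have hFi : Integrable F.1 (T.act lam) :=
    (Pair.integrable_dens_mul _ _ (Pair.memLp_dens _ hp) (q.memLp_dens aq)).congr hF
  rw [inner_mk _ _ hp aq, inner_mk _ _ a1 ar, integral_congr_ae hF, T.integral_act lam F hFi]
  refine integral_congr_ae (Eventually.of_forall fun x => ?_)
  have h := T.pull_out w f
  change _ = _
  rw [h]
  simp only [w, Pair.dens, hr, hrν]
  ring

/-- The operator `R̂ = Ŝ*`. -/
noncomputable def rHat (hT : T.Normalized) : UniversalHilbert X →L[ℝ] UniversalHilbert X :=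
  ContinuousLinearMap.adjoint (sHat hT).toContinuousLinearMap

theorem inner_rHat (hT : T.Normalized) (u v : UniversalHilbert X) :
    inner ℝ (sHat hT u) v = inner ℝ u (rHat hT v) :=
  (ContinuousLinearMap.adjoint_inner_right (sHat hT).toContinuousLinearMap u v).symm

theorem isRHat_rHat (hT : T.Normalized) : T.IsRHat (rHat hT) where
  of_K₁ := by
    rintro v f μ ⟨ν, hν, rfl⟩ ⟨q, hqf, hqμ, rfl⟩
    -- For `μ = νR` the target measure `μ ∘ σ⁻¹` is `ν` itself.
    rw [(measurePreserving_act hT ν).map_eq]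
    let r : Pair X :=
      { f := (T.R f).1
        μ := ν
        sigmaFinite := inferInstance
        measurable := (T.R f).2
        memLp := memLp_R hT f (by rw [← hqf, ← hqμ]; exact q.memLp) }
    -- The adjoint is known only through inner products, so the equality is tested against every
    -- vector.
    refine ⟨r, rfl, rfl, ext_inner_left ℝ fun u => ?_⟩
    obtain ⟨p, rfl⟩ := mk_surj u
    rw [← inner_rHat, inner_sHat hT p q r ν hqμ rfl f hqf rfl]
  of_orthogonal v hv := by
    cases isEmpty_or_nonempty X
    · exact Subsingleton.elim _ _
    · refine ext_inner_left ℝ fun u => ?_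
      rw [← inner_rHat, inner_zero_right]
      exact (Submodule.mem_orthogonal _ v).1 hv _ (sHat_mem_closedSpan hT u)

/-- Split `v` along `H_{K₁}` and its complement. The first component is a class over one measure in
`K₁`, so the formula gives its image directly, with no passage to limits; hence boundedness of the
competing maps is not required. -/
theorem IsRHat.unique (hT : T.Normalized)
    {R₁ R₂ : UniversalHilbert X →ₗ[ℝ] UniversalHilbert X} (h₁ : T.IsRHat R₁)
    (h₂ : T.IsRHat R₂) : R₁ = R₂ := by
  ext v
  cases isEmpty_or_nonempty X
  · exact Subsingleton.elim _ _
  have : CompleteSpace (closedSpan T.K₁) :=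
    (Submodule.isClosed_topologicalClosure _).completeSpace_coe
  obtain ⟨a, ha, b, hb, rfl⟩ := (closedSpan T.K₁).exists_add_mem_mem_orthogonal v
  rw [map_add, map_add, h₁.of_orthogonal b hb, h₂.of_orthogonal b hb]
  obtain ⟨μ, hμ, f, hf⟩ := exists_isClass_of_mem_closedSpan hT ha
  have hfm : Measurable f := by
    obtain ⟨p, rfl, -⟩ := hf
    exact p.measurable
  rw [(h₁.of_K₁ a ⟨f, hfm⟩ μ hμ hf).unique (h₂.of_K₁ a ⟨f, hfm⟩ μ hμ hf)]

end TransferOperator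

end SHat

end UniversalHilbert

end UHS

theorem mainTheorem8 {X : Type*} [MeasurableSpace X] [StandardBorelSpace X]
    (T : UHS.TransferOperator X) (hT : T.Normalized) :
    ∃ S R' : UHS.UniversalHilbert X →L[ℝ] UHS.UniversalHilbert X,
      (T.IsSHat S ∧
        ∀ S₁ : UHS.UniversalHilbert X → UHS.UniversalHilbert X, T.IsSHat S₁ → S₁ = S) ∧
      (T.IsRHat R' ∧
        ∀ R₁ : UHS.UniversalHilbert X →ₗ[ℝ] UHS.UniversalHilbert X, T.IsRHat R₁ →
          ∀ v, R₁ v = R' v) ∧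
      R' = ContinuousLinearMap.adjoint S ∧
      ∀ u v : UHS.UniversalHilbert X, inner ℝ (S u) v = inner ℝ u (R' v) :=
  ⟨(UHS.TransferOperator.sHat hT).toContinuousLinearMap, UHS.TransferOperator.rHat hT,
    ⟨UHS.TransferOperator.isSHat_sHat hT,
      fun _ h => h.unique (UHS.TransferOperator.isSHat_sHat hT)⟩,
    ⟨UHS.TransferOperator.isRHat_rHat hT, fun _ h v => LinearMap.congr_fun
      (UHS.TransferOperator.IsRHat.unique hT h
        (R₂ := (UHS.TransferOperator.rHat hT).toLinearMap)
        (UHS.TransferOperator.isRHat_rHat hT)) v⟩,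
    rfl, UHS.TransferOperator.inner_rHat hT⟩
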